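/- Let $n\ge 2$. For a set $C$ of unordered pairs of elements of $Z_{2n}=\{0,1,\dots,2n-1\}$ and $a\in Z_{2n}$ write $C+a=\{\{x+a,y+a\}:\{x,y\}\in C\}$ (addition modulo $2n$). **C-Codes.** A C-Code of length $2n$ is a binary linear code with a parity-check matrix $\mathbf H=(H_0\,H_1\,\cdots\,H_{2n-1})$ whose blocks $H_k$ are binary $2n\times n$ matrices (rows numbered $0,\dots,2n-1$) such that: (1) the last column of $H_k$ is the $k$-th column of the $2n\times 2n$ identity matrix, for every $k$; (2) $H_k=E^kH_0$ for every $k$, where $E$ is the cyclic permutation matrix whose $(i,j)$ entry is $1$ if and only if $i\equiv j+1 \pmod{2n}$; (3) every row of $\mathbf H$ has exactly $2n-1$ ones; (4) for all $0\le m<k\le 2n-1$ the square matrix $(H_m\ H_k)$ is nonsingular over $\mathbb F_2$. A set $C_0$ of $n-1$ pairs of distinct elements of $Z_{2n}$ *is a C-Code of length $2n$* if there is a C-Code with such a matrix $\mathbf H$ in which, for every $k$, the first $n-1$ columns of $H_k$ are, in some order, the incidence vectors of the pairs in $C_0+k$, each occurring once. If exactly one non-zero element $r$ of $Z_{2n}$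 occurs in no pair of $C_0$, the *twin* of $C_0$ is $C_0^\tau=C_0+(-r)$. **Even starters.** Let $A$ be an abelian group (written multiplicatively) of order $2n$ with identity $e$ and a unique element $a^*$ of order $2$. An even starter in $A$ is a set of $n-1$ pairs of distinct non-identity elements of $A$ such that every $i\in A\setminus\{e,a^*\}$ equals $x^{-1}y$ or $xy^{-1}$ for some pair $\{x,y\}$ of the set. **Theorem.** Let $p\ge 5$ be a prime, let $g$ be a generator of the multiplicative group $Z_p^*$, and for $x\in Z_p^*$ let $\log_g x\in Z_{p-1}$ be the exponent with $g^{\log_g x}=x$. Then $$\widehat S^A=\{\{x,y\}:x,y\in Z_p^*\setminus\{1,2^{-1}\},\ x+y=1\},$$ $$\widehat S^B=\{\{x,y\}:x,y\in Z_p^*\setminus\{1,2^{-1},2,p-1\},\ x+y=1\}\cup\{\{2^{-1},p-1\}\}$$ are even starters in $Z_p^*$. Put $$C_0^A=\{\{\log_g x,\log_g y\}:\{x,y\}\in\widehat S^A\},\qquad C_0^B=\{\{\log_g x,\log_g y\}:\{x,y\}\in\widehat S^B\}.$$ Each of $C_0^A$ and $C_0^B$ omits exactly one non-zero element of $Z_{p-1}$,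 so the twins $(C_0^A)^\tau$ and $(C_0^B)^\tau$ are defined, and all four of $$C_0^A,\quad (C_0^A)^\tau,\quad C_0^B,\quad (C_0^B)^\tau$$ are C-Codes of length $p-1$. For $p\ge 7$ these four sets are pairwise distinct. -/

import Mathlib

namespace CCode

/-- The binary elemental cyclic matrix `E` of size `2n × 2n`, rows and columns numbered by
`0, 1, …, 2n - 1` (the elements of `ZMod (2 * n)`): row `0` has its only `1` in column `2n - 1`,
and row `i ≥ 1` has its only `1` in column `i - 1`. -/
def elemCyclic (n : ℕ) : Matrix (ZMod (2 * n)) (ZMod (2 * n)) (ZMod 2) :=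
  Matrix.of fun i j => if i = j + 1 then 1 else 0

/-- The `k`-th block `H_k` (of size `2n × n`) of `H = (H_0 H_1 ⋯ H_{2n-1})`. -/
def block {n : ℕ} (H : Matrix (ZMod (2 * n)) (ZMod (2 * n) × Fin n) (ZMod 2))
    (k : ZMod (2 * n)) : Matrix (ZMod (2 * n)) (Fin n) (ZMod 2) :=
  Matrix.of fun i j => H i (k, j)

/-- `H = (H_0 H_1 ⋯ H_{2n-1})` is the parity-check matrix of a C-Code of length `2n`. -/
structure IsParityCheck {n : ℕ} [NeZero n]
    (H : Matrix (ZMod (2 * n)) (ZMod (2 * n) × Fin n) (ZMod 2)) : Prop where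
  /-- The last column of `H_k` is the `k`-th column of the identity matrix. -/
  last_col : ∀ (k : ZMod (2 * n)) (j : Fin n), (j : ℕ) + 1 = n →
    ∀ i, block H k i j = (1 : Matrix (ZMod (2 * n)) (ZMod (2 * n)) (ZMod 2)) i k
  /-- `H_k = E ^ k * H_0`. -/
  cyclic : ∀ k : ZMod (2 * n), block H k = elemCyclic n ^ k.val * block H 0
  /-- Each row of `H` has exactly `2n - 1` ones. -/
  row_weight : ∀ i : ZMod (2 * n),
    (Finset.univ.filter fun c : ZMod (2 * n) × Fin n => H i c = 1).card = 2 * n - 1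
  /-- For `m ≠ k` the square matrix `(H_m H_k)` is nonsingular. -/
  nonsingular : ∀ m k : ZMod (2 * n), m ≠ k →
    Function.Bijective (Matrix.fromCols (block H m) (block H k)).mulVec

/-- The binary linear code with parity-check matrix `H`. Position `(k, j)` of a codeword is the bit
in row `j` of the `k`-th column of the `n × 2n` array. -/
def codeOf {n : ℕ} [NeZero n] (H : Matrix (ZMod (2 * n)) (ZMod (2 * n) × Fin n) (ZMod 2)) :
    Submodule (ZMod 2) (ZMod (2 * n) × Fin n → ZMod 2) :=
  LinearMap.ker H.mulVecLin

/-- The translate `{{x + a, y + a} : {x, y} ∈ C}`. -/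
def translate {N : ℕ} (a : ZMod N) (C : Set (Sym2 (ZMod N))) : Set (Sym2 (ZMod N)) :=
  Sym2.map (fun x => x + a) '' C

/-- Column `j` of `H_k` is the incidence vector of the edge `e` (two distinct vertices): the
corresponding information bit is protected by exactly the two parity bits in `e`. -/
def IsEdgeOf {n : ℕ} (H : Matrix (ZMod (2 * n)) (ZMod (2 * n) × Fin n) (ZMod 2))
    (k : ZMod (2 * n)) (j : Fin n) (e : Sym2 (ZMod (2 * n))) : Prop :=
  ¬ e.IsDiag ∧ ∀ i, (i ∈ e → block H k i j = 1) ∧ (i ∉ e → block H k i j = 0)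

/-- The graph description of `H` is given by the first column `C₀`: for every `k`, the first `n - 1`
columns of `H_k` (the information bits in the `k`-th column of the array) are the edges in
`C_k = {{x + k, y + k} : {x, y} ∈ C₀}`, each occurring exactly once. -/
def IsDescribedBy {n : ℕ} (H : Matrix (ZMod (2 * n)) (ZMod (2 * n) × Fin n) (ZMod 2))
    (C₀ : Set (Sym2 (ZMod (2 * n)))) : Prop :=
  ∀ k : ZMod (2 * n),
    (∀ j : Fin n, (j : ℕ) + 1 < n → ∃ e ∈ translate k C₀, IsEdgeOf H k j e) ∧
    (∀ e ∈ translate k C₀, ∃! j : Fin n, (j : ℕ) + 1 < n ∧ IsEdgeOf H k j e)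

/-- `𝒞` is a C-Code of length `2n` whose first column, in the graph description, is `C₀`. -/
def IsCCode {n : ℕ} [NeZero n]
    (𝒞 : Submodule (ZMod 2) (ZMod (2 * n) × Fin n → ZMod 2))
    (C₀ : Set (Sym2 (ZMod (2 * n)))) : Prop :=
  ∃ H : Matrix (ZMod (2 * n)) (ZMod (2 * n) × Fin n) (ZMod 2),
    IsParityCheck H ∧ IsDescribedBy H C₀ ∧ 𝒞 = codeOf H

/-- `T` is the twin `{{x - r, y - r} : {x, y} ∈ C}` of `C`, where `r` is the one and only non-zero
element that does not occur in `C`. -/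
def IsTwin {N : ℕ} (C T : Set (Sym2 (ZMod N))) : Prop :=
  ∃ r : ZMod N, (∀ a : ZMod N, (a ≠ 0 ∧ ∀ e ∈ C, a ∉ e) ↔ a = r) ∧ T = translate (-r) C

/-- `S` is an even starter in the abelian group `A`, which has order `2n` and a unique element of
order `2`: a set of `n - 1` pairs of non-identity elements such that every element other than the
identity and the element of order `2` is a quotient of the two elements of some pair. -/
structure IsEvenStarter {A : Type*} [CommGroup A] (n : ℕ) (S : Set (Sym2 A)) : Prop where
  card_group : Nat.card A = 2 * n
  unique_order_two : ∃! a : A, orderOf a = 2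
  finite : S.Finite
  card : S.ncard = n - 1
  pair : ∀ e ∈ S, ¬ e.IsDiag ∧ (1 : A) ∉ e
  quotient : ∀ i : A, i ≠ 1 → orderOf i ≠ 2 →
    ∃ x y : A, s(x, y) ∈ S ∧ (i = x⁻¹ * y ∨ i = x * y⁻¹)

/-- `{{x, y} : x, y ∈ Z_p^* \ {1, 2⁻¹}, x + y = 1}`. -/
def starterA (p : ℕ) : Set (Sym2 (ZMod p)ˣ) :=
  {e | ∃ x y : (ZMod p)ˣ, e = s(x, y) ∧
    (x : ZMod p) ∉ ({1, 2⁻¹} : Set (ZMod p)) ∧ (y : ZMod p) ∉ ({1, 2⁻¹} : Set (ZMod p)) ∧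
    (x : ZMod p) + (y : ZMod p) = 1}

/-- `{{x, y} : x, y ∈ Z_p^* \ {1, 2⁻¹, 2, p - 1}, x + y = 1} ∪ {{2⁻¹, p - 1}}`. -/
def starterB (p : ℕ) : Set (Sym2 (ZMod p)ˣ) :=
  {e | ∃ x y : (ZMod p)ˣ, e = s(x, y) ∧
    (x : ZMod p) ∉ ({1, 2⁻¹, 2, -1} : Set (ZMod p)) ∧
    (y : ZMod p) ∉ ({1, 2⁻¹, 2, -1} : Set (ZMod p)) ∧
    (x : ZMod p) + (y : ZMod p) = 1} ∪
  {e | ∃ x y : (ZMod p)ˣ, e = s(x, y) ∧ (x : ZMod p) = 2⁻¹ ∧ (y : ZMod p) = -1}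

/-- The discrete logarithm to the base `g`, as a residue modulo `N` (meant for a generator `g` of a
cyclic group of order `N`): the residue of the least exponent `i` with `g ^ i = x`. -/
noncomputable def dlog {A : Type*} [Group A] (N : ℕ) (g x : A) : ZMod N :=
  ((sInf {i : ℕ | g ^ i = x} : ℕ) : ZMod N)

/-- `{{log_g x, log_g y} : {x, y} ∈ S}`. -/
noncomputable def logPairs {A : Type*} [Group A] (N : ℕ) (g : A) (S : Set (Sym2 A)) :
    Set (Sym2 (ZMod N)) :=
  Sym2.map (dlog N g) '' S

end CCode

namespace CCode

open Function

/-! A row vector killed by `(H_m H_k)` is a function `f` that vanishes at `m` and `k` and is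
constant along each edge of `C + m` and of `C + k`. Nonsingularity therefore says that only `f = 0`
qualifies, which is what `IsAdmissible` records; the remaining C-Code conditions hold for the cyclic
matrix built from any `n - 1` genuine edges.

The discrete logarithm turns translation by `m` into multiplication by a unit `a`, and each starter
is the set of 2-cycles of an involution `σ` of the units with exactly two fixed points, `1` and some
`ρ`. For A, `σ` is `x ↦ 1 - x`, and its translate by `a` is `z ↦ a - z`. Extending `f` by `F 0 = 0`
makes `F` invariant under this reflection on all of `ZMod p`, since `a` and `0` are swapped and `f a
= 0`. Two distinct reflections compose to a nonzero translation, which is transitive because `p` is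
prime, so `F = 0` (`eq_zero_of_reflections`).

For B, invariance may fail at `2a` and `-a`; in exchange `F (a / 2) = F (-a)`. The loss is made up
by parity: modulo 2, summing `f` over the group leaves only the fixed points, so `f a + f (ρ a) = f
b + f (ρ b)` (`apply_mul_eq_of_sum`). With `ρ = 2` this gives `F (2a) = F (2b)`, and
`eq_of_switched_reflections` concludes. The same parity identity carries the separating property
over to twins (`IsSeparating.conjMul`). -/

/-- A set of `n - 1` edges on `ZMod (2 * n)` such that, for `m ≠ k`, every vertex is joined to `m` or
to `k` in the union of its translates by `m` and by `k` (expressed through `ZMod 2`-valued functions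
which are constant on components). -/
structure IsAdmissible {n : ℕ} (C : Set (Sym2 (ZMod (2 * n)))) : Prop where
  card : C.ncard = n - 1
  not_isDiag : ∀ e ∈ C, ¬ e.IsDiag
  eq_zero : ∀ m k : ZMod (2 * n), m ≠ k → ∀ f : ZMod (2 * n) → ZMod 2, f m = 0 → f k = 0 →
    (∀ x y, s(x, y) ∈ C → f (x + m) = f (y + m)) →
    (∀ x y, s(x, y) ∈ C → f (x + k) = f (y + k)) → f = 0

/-! ### Parity-check matrices from admissible edge sets -/

/-- The first block: the columns are the incidence vectors of `c 0, …, c (n - 2)` and of `{0}`. -/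
def initialBlock {n : ℕ} (c : Fin n → Sym2 (ZMod (2 * n))) (i : ZMod (2 * n)) (j : Fin n) :
    ZMod 2 :=
  open Classical in
  if (j : ℕ) + 1 = n then (if i = 0 then 1 else 0) else (if i ∈ c j then 1 else 0)

/-- The matrix whose `k`-th block is the `k`-th cyclic shift of the initial block. -/
def cyclicMatrix {n : ℕ} (c : Fin n → Sym2 (ZMod (2 * n))) :
    Matrix (ZMod (2 * n)) (ZMod (2 * n) × Fin n) (ZMod 2) :=
  Matrix.of fun i q => initialBlock c (i - q.1) q.2

theorem block_cyclicMatrix {n : ℕ} (c : Fin n → Sym2 (ZMod (2 * n))) (k i : ZMod (2 * n))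
    (j : Fin n) : block (cyclicMatrix c) k i j = initialBlock c (i - k) j := rfl

theorem initialBlock_of_lt {n : ℕ} (c : Fin n → Sym2 (ZMod (2 * n))) {j : Fin n}
    (hj : (j : ℕ) + 1 < n) (i : ZMod (2 * n)) [Decidable (i ∈ c j)] :
    initialBlock c i j = if i ∈ c j then 1 else 0 := by
  simp [initialBlock, hj.ne]

theorem initialBlock_of_eq {n : ℕ} (c : Fin n → Sym2 (ZMod (2 * n))) {j : Fin n}
    (hj : (j : ℕ) + 1 = n) (i : ZMod (2 * n)) :
    initialBlock c i j = if i = 0 then 1 else 0 := by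
  simp [initialBlock, hj]

theorem elemCyclic_pow_mul {n : ℕ} [NeZero n] {ι : Type*}
    (A : Matrix (ZMod (2 * n)) ι (ZMod 2)) (m : ℕ) (i : ZMod (2 * n)) (j : ι) :
    (elemCyclic n ^ m * A) i j = A (i - m) j := by
  induction m generalizing i with
  | zero => simp
  | succ m ih =>
    rw [pow_succ', Matrix.mul_assoc, Matrix.mul_apply, Finset.sum_eq_single (i - 1)]
    · rw [ih]
      simp [elemCyclic, sub_sub, add_comm]
    · intro b _ hb
      have : i ≠ b + 1 := fun h => hb (by rw [h]; ring)
      simp [elemCyclic, this]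
    · simp

theorem mem_sym2_map_add {N : ℕ} (k i : ZMod N) (e : Sym2 (ZMod N)) :
    i ∈ Sym2.map (fun x => x + k) e ↔ i - k ∈ e := by
  rw [Sym2.mem_map]
  constructor
  · rintro ⟨a, ha, rfl⟩
    simpa using ha
  · intro h
    exact ⟨_, h, by ring⟩

theorem isDiag_map_add {N : ℕ} (k : ZMod N) (e : Sym2 (ZMod N)) :
    (Sym2.map (fun x => x + k) e).IsDiag ↔ e.IsDiag := by
  induction e with
  | _ x y => simp

theorem isEdgeOf_cyclicMatrix_iff {n : ℕ} (c : Fin n → Sym2 (ZMod (2 * n)))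
    {j : Fin n} (hj : (j : ℕ) + 1 < n) (hd : ¬ (c j).IsDiag) (k : ZMod (2 * n))
    (e : Sym2 (ZMod (2 * n))) :
    IsEdgeOf (cyclicMatrix c) k j e ↔ e = Sym2.map (fun x => x + k) (c j) := by
  classical
  constructor
  · rintro ⟨-, h⟩
    refine Sym2.ext fun i => ?_
    rw [mem_sym2_map_add]
    have := h i
    rw [block_cyclicMatrix, initialBlock_of_lt c hj] at this
    by_cases hi : i ∈ e <;> by_cases hi' : i - k ∈ c j <;> simp_all
  · rintro rfl
    refine ⟨by rwa [isDiag_map_add], fun i => ?_⟩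
    rw [block_cyclicMatrix, initialBlock_of_lt c hj, mem_sym2_map_add]
    by_cases hi' : i - k ∈ c j <;> simp_all

theorem isDescribedBy_cyclicMatrix {n : ℕ} {C : Set (Sym2 (ZMod (2 * n)))}
    (hC : ∀ e ∈ C, ¬ e.IsDiag) (c : Fin n → Sym2 (ZMod (2 * n)))
    (hc : ∀ j : Fin n, (j : ℕ) + 1 < n → c j ∈ C)
    (hc' : ∀ e ∈ C, ∃! j : Fin n, (j : ℕ) + 1 < n ∧ c j = e) :
    IsDescribedBy (cyclicMatrix c) C := by
  intro k
  constructor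
  · intro j hj
    exact ⟨_, ⟨_, hc j hj, rfl⟩,
      (isEdgeOf_cyclicMatrix_iff c hj (hC _ (hc j hj)) k _).2 rfl⟩
  · rintro _ ⟨e, he, rfl⟩
    obtain ⟨j, ⟨hj, rfl⟩, hu⟩ := hc' e he
    refine ⟨j, ⟨hj, (isEdgeOf_cyclicMatrix_iff c hj (hC _ he) k _).2 rfl⟩, ?_⟩
    rintro j' ⟨hj', h⟩
    rw [isEdgeOf_cyclicMatrix_iff c hj' (hC _ (hc j' hj'))] at h
    exact hu j' ⟨hj', Sym2.map.injective (add_left_injective k) h.symm⟩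

theorem card_filter_initialBlock {n : ℕ} [NeZero n] (c : Fin n → Sym2 (ZMod (2 * n)))
    (j : Fin n) (hd : (j : ℕ) + 1 < n → ¬ (c j).IsDiag) :
    (Finset.univ.filter fun z => initialBlock c z j = 1).card =
      if (j : ℕ) + 1 = n then 1 else 2 := by
  classical
  split_ifs with hj
  · rw [Finset.card_eq_one]
    exact ⟨0, by ext z; simp [initialBlock_of_eq c hj]⟩
  · have hj' : (j : ℕ) + 1 < n := by omega
    have := hd hj'
    simp only [initialBlock_of_lt c hj']
    generalize c j = e at this
    induction e with
    | _ x y =>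
      rw [Finset.card_eq_two]
      exact ⟨x, y, by simpa using this, by ext z; simp [or_iff_not_imp_left]⟩

theorem sum_ite_last (n : ℕ) [NeZero n] :
    ∑ j : Fin n, (if (j : ℕ) + 1 = n then 1 else 2) = 2 * n - 1 := by
  obtain ⟨m, rfl⟩ := Nat.exists_eq_succ_of_ne_zero (NeZero.ne n)
  rw [Fin.sum_univ_castSucc]
  have : ∀ j : Fin m, (j : ℕ) ≠ m := fun j => j.2.ne
  simp [this]
  omega

/-- Row `i` of block `k` is row `i - k` of the first block, so a full row collects every entry of
the first block once: `n - 1` columns of weight 2 and one of weight 1. -/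
theorem row_weight_cyclicMatrix {n : ℕ} [NeZero n] (c : Fin n → Sym2 (ZMod (2 * n)))
    (hd : ∀ j : Fin n, (j : ℕ) + 1 < n → ¬ (c j).IsDiag) (i : ZMod (2 * n)) :
    (Finset.univ.filter fun q : ZMod (2 * n) × Fin n => cyclicMatrix c i q = 1).card =
      2 * n - 1 := by
  rw [← sum_ite_last n, Finset.card_filter, Fintype.sum_prod_type_right]
  refine Finset.sum_congr rfl fun j _ => ?_
  rw [← card_filter_initialBlock c j (hd j), Finset.card_filter]
  exact (Equiv.subLeft i).sum_comp (fun z => if initialBlock c z j = 1 then 1 else 0)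

/-- A square matrix with trivial left kernel is invertible. Rows and columns carry different index
types here, hence the reindexing by `e`. -/
theorem mulVec_bijective_of_vecMul_eq_zero {ι κ K : Type*} [Fintype ι] [Fintype κ]
    [DecidableEq ι] [DecidableEq κ] [Field K] (hcard : Fintype.card ι = Fintype.card κ)
    (M : Matrix ι κ K) (h : ∀ f : ι → K, Matrix.vecMul f M = 0 → f = 0) :
    Function.Bijective M.mulVec := by
  have e : ι ≃ κ := Fintype.equivOfCardEq hcard
  have hinj : Function.Injective (Matrix.vecMul · (M.submatrix id e)) := by
    have : Function.Injective (M.submatrix id e).vecMulLinear := by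
      rw [injective_iff_map_eq_zero]
      intro f hf
      refine h f (funext fun q => ?_)
      have := congrFun hf (e.symm q)
      simpa [Matrix.vecMul, dotProduct] using this
    exact this
  have hu := Matrix.vecMul_injective_iff_isUnit.1 hinj
  have hb : Function.Bijective (M.submatrix id e).mulVec :=
    ⟨Matrix.mulVec_injective_iff_isUnit.2 hu, Matrix.mulVec_surjective_iff_isUnit.2 hu⟩
  have : M.mulVec = (M.submatrix id e).mulVec ∘ fun v => v ∘ e := by
    funext v
    have := Matrix.submatrix_mulVec_equiv M (v ∘ e) id e
    simp only [Function.comp_assoc, Equiv.self_comp_symm, Function.comp_id] at this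
    exact this.symm
  rw [this]
  exact hb.comp (e.arrowCongr (Equiv.refl K)).symm.bijective

theorem vecMul_block_of_eq {n : ℕ} [NeZero n] (c : Fin n → Sym2 (ZMod (2 * n)))
    (f : ZMod (2 * n) → ZMod 2) (k : ZMod (2 * n)) {j : Fin n} (hj : (j : ℕ) + 1 = n) :
    Matrix.vecMul f (block (cyclicMatrix c) k) j = f k := by
  simp [Matrix.vecMul, dotProduct, block_cyclicMatrix, initialBlock_of_eq c hj, sub_eq_zero]

theorem vecMul_block_of_lt {n : ℕ} [NeZero n] (c : Fin n → Sym2 (ZMod (2 * n)))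
    (f : ZMod (2 * n) → ZMod 2) (k : ZMod (2 * n)) {j : Fin n} (hj : (j : ℕ) + 1 < n)
    {x y : ZMod (2 * n)} (hxy : x ≠ y) (hc : c j = s(x, y)) :
    Matrix.vecMul f (block (cyclicMatrix c) k) j = f (x + k) + f (y + k) := by
  classical
  rw [Matrix.vecMul, dotProduct, ← Equiv.sum_comp (Equiv.addRight k)]
  simp only [block_cyclicMatrix, initialBlock_of_lt c hj, Equiv.coe_addRight, add_sub_cancel_right,
    hc, Sym2.mem_iff, mul_ite, mul_one, mul_zero]
  rw [← Finset.sum_filter, ← Finset.sum_pair hxy (f := fun z => f (z + k))]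
  congr 1
  ext z
  simp

theorem IsAdmissible.exists_isCCode {n : ℕ} [NeZero n] {C : Set (Sym2 (ZMod (2 * n)))}
    (hC : IsAdmissible C) : ∃ 𝒞, IsCCode 𝒞 C := by
  classical
  have hlast : ∃ l : Fin n, (l : ℕ) + 1 = n :=
    ⟨⟨n - 1, Nat.sub_lt (NeZero.pos n) one_pos⟩, Nat.sub_add_cancel (NeZero.pos n)⟩
  obtain ⟨l, hl⟩ := hlast
  have hcard : Nat.card (Fin (n - 1)) = Nat.card C := by
    rw [Nat.card_eq_fintype_card, Fintype.card_fin, Nat.card_coe_set_eq, hC.card]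
  obtain ⟨ε⟩ : Nonempty (Fin (n - 1) ≃ C) := Finite.card_eq.1 hcard
  let c : Fin n → Sym2 (ZMod (2 * n)) := fun j =>
    if h : (j : ℕ) + 1 < n then (ε ⟨j, by omega⟩ : Sym2 (ZMod (2 * n))) else s(0, 0)
  have hcj : ∀ j : Fin n, ∀ h : (j : ℕ) + 1 < n, c j = ε ⟨j, by omega⟩ := fun j h => by
    simp [c, h]
  have hc : ∀ j : Fin n, (j : ℕ) + 1 < n → c j ∈ C := fun j h => by
    rw [hcj j h]
    exact Subtype.coe_prop _
  have hc' : ∀ e ∈ C, ∃! j : Fin n, (j : ℕ) + 1 < n ∧ c j = e := by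
    intro e he
    obtain ⟨i, hi⟩ := ε.surjective ⟨e, he⟩
    have hi2 := i.2
    have h1 : ((⟨i, by omega⟩ : Fin n) : ℕ) + 1 < n := by
      show (i : ℕ) + 1 < n
      omega
    refine ⟨⟨i, by omega⟩, ⟨h1, ?_⟩, ?_⟩
    · rw [hcj _ h1]
      exact congrArg Subtype.val hi
    · rintro j ⟨hj, hje⟩
      rw [hcj j hj] at hje
      have : ε ⟨j, by omega⟩ = ε i := by
        rw [hi]
        exact Subtype.ext hje
      have := congrArg Fin.val (ε.injective this)
      exact Fin.ext this
  refine ⟨codeOf (cyclicMatrix c), cyclicMatrix c, ⟨?_, ?_, ?_, ?_⟩,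
    isDescribedBy_cyclicMatrix hC.not_isDiag c hc hc', rfl⟩
  · intro k j hj i
    rw [block_cyclicMatrix, initialBlock_of_eq c hj, Matrix.one_apply]
    simp [sub_eq_zero]
  · intro k
    ext i j
    rw [elemCyclic_pow_mul]
    simp [block_cyclicMatrix]
  · exact row_weight_cyclicMatrix c fun j hj => hC.not_isDiag _ (hc j hj)
  · intro m k hmk
    refine mulVec_bijective_of_vecMul_eq_zero (by simp [ZMod.card, two_mul]) _ fun f hf => ?_
    rw [Matrix.vecMul_fromCols] at hf
    have hm : Matrix.vecMul f (block (cyclicMatrix c) m) = 0 :=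
      funext fun j => congrFun hf (Sum.inl j)
    have hk : Matrix.vecMul f (block (cyclicMatrix c) k) = 0 :=
      funext fun j => congrFun hf (Sum.inr j)
    have key : ∀ k', Matrix.vecMul f (block (cyclicMatrix c) k') = 0 →
        f k' = 0 ∧ ∀ x y, s(x, y) ∈ C → f (x + k') = f (y + k') := by
      intro k' h
      refine ⟨by rw [← vecMul_block_of_eq c f k' hl, h]; rfl, fun x y hxy => ?_⟩
      obtain ⟨j, ⟨hj, hje⟩, -⟩ := hc' _ hxy
      have := vecMul_block_of_lt c f k' hj (by simpa using hC.not_isDiag _ hxy) hje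
      rw [h] at this
      exact CharTwo.add_eq_zero.1 this.symm
    exact hC.eq_zero m k hmk f (key m hm).1 (key k hk).1 (key m hm).2 (key k hk).2


/-! ### Involutions and their matchings -/

/-- The edges `{x, σ x}` with `x` not a fixed point of `σ`. -/
def matching {A : Type*} (σ : A → A) : Set (Sym2 A) :=
  {e | ∃ x, σ x ≠ x ∧ e = s(x, σ x)}

section Matching

variable {A : Type*} {σ : A → A}

theorem mk_mem_matching (hσ : Involutive σ) {x y : A} :
    s(x, y) ∈ matching σ ↔ σ x = y ∧ x ≠ y := by
  constructor
  · rintro ⟨z, hz, h⟩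
    rcases Sym2.eq_iff.1 h with ⟨rfl, rfl⟩ | ⟨rfl, rfl⟩
    · exact ⟨rfl, hz.symm⟩
    · exact ⟨hσ _, hz⟩
  · rintro ⟨rfl, h⟩
    exact ⟨x, h.symm, rfl⟩

theorem not_isDiag_of_mem_matching {e : Sym2 A} (he : e ∈ matching σ) : ¬ e.IsDiag := by
  obtain ⟨x, hx, rfl⟩ := he
  simpa using hx.symm

theorem exists_mem_matching (hσ : Involutive σ) (x : A) :
    (∃ e ∈ matching σ, x ∈ e) ↔ σ x ≠ x := by
  constructor
  · rintro ⟨e, he, hx⟩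
    obtain ⟨y, rfl⟩ := hx
    obtain ⟨rfl, h⟩ := (mk_mem_matching hσ).1 he
    exact h.symm
  · intro h
    exact ⟨_, ⟨x, h, rfl⟩, Sym2.mem_mk_left _ _⟩

/-- The fixed points are exactly the uncovered vertices, so the edges determine the involution. -/
theorem matching_injective {τ : A → A} (hσ : Involutive σ) (hτ : Involutive τ)
    (h : matching σ = matching τ) : σ = τ := by
  funext x
  by_cases hx : σ x = x
  · have h1 : ¬ ∃ e ∈ matching τ, x ∈ e := by
      rw [← h, exists_mem_matching hσ]
      exact not_not.2 hx
    rw [exists_mem_matching hτ, not_not] at h1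
    rw [hx, h1]
  · have : s(x, σ x) ∈ matching τ := h ▸ ⟨x, hx, rfl⟩
    exact ((mk_mem_matching hτ).1 this).1.symm

theorem sum_eq_of_involutive [Fintype A] (hσ : Involutive σ) {a b : A} (hab : a ≠ b)
    (hfix : ∀ x, σ x = x ↔ x = a ∨ x = b) (f : A → ZMod 2) (hf : ∀ x, f (σ x) = f x) :
    ∑ x, f x = f a + f b := by
  classical
  rw [← Finset.sum_pair hab, ← Finset.sum_sdiff (Finset.subset_univ {a, b}), add_eq_right]
  refine Finset.sum_involution (fun x _ => σ x) (fun x _ => ?_) (fun x hx _ => ?_)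
    (fun x hx => ?_) (fun x _ => hσ x)
  · rw [hf, CharTwo.add_self_eq_zero]
  · rw [Ne, hfix]
    simpa using hx
  · have h1 : ¬ σ x = x := by
      rw [hfix]
      simpa using hx
    have h2 : ¬ σ (σ x) = σ x := by
      rw [hσ x]
      exact fun h => h1 h.symm
    rw [hfix] at h2
    simpa using h2

theorem ncard_matching [Finite A] (hσ : Involutive σ) {n : ℕ} (hA : Nat.card A = 2 * n) {a b : A}
    (hab : a ≠ b) (hfix : ∀ x, σ x = x ↔ x = a ∨ x = b) : (matching σ).ncard = n - 1 := by
  classical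
  have := Fintype.ofFinite A
  let M : Finset (Sym2 A) := ({a, b}ᶜ : Finset A).image fun x => s(x, σ x)
  have hmem : ∀ x, x ∈ ({a, b}ᶜ : Finset A) ↔ σ x ≠ x := fun x => by simp [hfix]
  have hM : matching σ = M := by
    ext e
    simp only [matching, Set.mem_ofPred_eq, M, Finset.coe_image, Set.mem_image, Finset.mem_coe, hmem]
    exact exists_congr fun x => and_congr_right fun _ => eq_comm
  -- Double counting: each edge is the image of exactly its two endpoints.
  have hsum := Finset.card_eq_sum_card_image (fun x => s(x, σ x)) ({a, b}ᶜ : Finset A)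
  rw [Finset.sum_congr rfl (g := fun _ => 2), Finset.sum_const, Finset.card_compl,
    Finset.card_pair hab, ← Nat.card_eq_fintype_card, hA, smul_eq_mul] at hsum
  · rw [hM, Set.ncard_coe_finset]
    change 2 * n - 2 = M.card * 2 at hsum
    omega
  · intro e he
    obtain ⟨x, hx, rfl⟩ := Finset.mem_image.1 he
    rw [hmem] at hx
    rw [Finset.card_eq_two]
    refine ⟨x, σ x, hx.symm, ?_⟩
    ext y
    simp only [Finset.mem_filter, hmem, Finset.mem_insert, Finset.mem_singleton, Sym2.eq_iff]
    constructor
    · rintro ⟨-, h | h⟩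
      · exact Or.inl h.1
      · exact Or.inr h.1
    · rintro (rfl | rfl)
      · exact ⟨hx, by simp⟩
      · exact ⟨by rw [hσ]; exact hx.symm, Or.inr ⟨rfl, hσ x⟩⟩

end Matching

/-! ### Separating involutions, twins and passage to logarithms -/

section Separating

variable {A : Type*} [CommGroup A]

/-- For `a ≠ b`, every element of `A` is joined to `a` or to `b` in the union of the translates of
the matching of `σ` by `a` and by `b`. -/
def IsSeparating (σ : A → A) : Prop :=
  ∀ a b : A, a ≠ b → ∀ f : A → ZMod 2, f a = 0 → f b = 0 →
    (∀ x, f (σ x * a) = f (x * a)) → (∀ x, f (σ x * b) = f (x * b)) → f = 0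

/-- The conjugate of `σ` by the multiplication by `ρ`. -/
def conjMul (ρ : A) (σ : A → A) (x : A) : A := σ (x * ρ) * ρ⁻¹

theorem conjMul_involutive {σ : A → A} (hσ : Involutive σ) (ρ : A) :
    Involutive (conjMul ρ σ) := fun x => by simp [conjMul, hσ (x * ρ)]

theorem conjMul_eq_self_iff {σ : A → A} {ρ : A} (hfix : ∀ x, σ x = x ↔ x = 1 ∨ x = ρ) (x : A) :
    conjMul ρ σ x = x ↔ x = 1 ∨ x = ρ⁻¹ := by
  rw [conjMul, mul_inv_eq_iff_eq_mul, hfix, or_comm, mul_eq_right, mul_eq_one_iff_eq_inv]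

/-- Both sides equal the sum of `f` over the whole group: the translate by `c` pairs off everything
except `c` and `ρ * c`, and paired values cancel modulo 2. -/
theorem apply_mul_eq_of_sum [Finite A] {σ : A → A} (hσ : Involutive σ) {ρ : A} (hρ : ρ ≠ 1)
    (hfix : ∀ x, σ x = x ↔ x = 1 ∨ x = ρ) {f : A → ZMod 2} {a b : A}
    (ha : ∀ x, f (σ x * a) = f (x * a)) (hb : ∀ x, f (σ x * b) = f (x * b)) :
    f a + f (ρ * a) = f b + f (ρ * b) := by
  have := Fintype.ofFinite A
  have key : ∀ c, (∀ x, f (σ x * c) = f (x * c)) → ∑ x, f x = f c + f (ρ * c) := by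
    intro c hc
    have := sum_eq_of_involutive hσ hρ.symm hfix (fun x => f (x * c)) hc
    rw [one_mul] at this
    rw [← this]
    exact (Equiv.sum_comp (Equiv.mulRight c) f).symm
  rw [← key a ha, key b hb]

/-- For the twin, `f` vanishes at the second fixed points of the shifted matchings rather than at
their base points `ρ⁻¹ * a` and `ρ⁻¹ * b`. Parity makes `f` agree at these base points, so
subtracting the common value reduces to the separating property of `σ`. -/
theorem IsSeparating.conjMul [Finite A] {σ : A → A} (h : IsSeparating σ) (hσ : Involutive σ) {ρ : A}
    (hρ : ρ ≠ 1) (hfix : ∀ x, σ x = x ↔ x = 1 ∨ x = ρ) : IsSeparating (conjMul ρ σ) := by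
  intro a b hab f ha hb hfa hfb
  have key : ∀ c, (∀ x, f (CCode.conjMul ρ σ x * c) = f (x * c)) →
      ∀ x, f (σ x * (ρ⁻¹ * c)) = f (x * (ρ⁻¹ * c)) := by
    intro c hc x
    have := hc (x * ρ⁻¹)
    rw [CCode.conjMul, inv_mul_cancel_right] at this
    simpa only [mul_assoc] using this
  have ha' := key a hfa
  have hb' := key b hfb
  have hs := apply_mul_eq_of_sum hσ hρ hfix ha' hb'
  rw [mul_inv_cancel_left, mul_inv_cancel_left, ha, hb, add_zero, add_zero] at hs
  have := h (ρ⁻¹ * a) (ρ⁻¹ * b) (by simpa using hab) (fun x => f x - f (ρ⁻¹ * a)) (sub_self _)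
    (by rw [hs, sub_self]) (fun x => by rw [ha']) (fun x => by rw [hb'])
  -- The function is now known to be constant; its value at `a` shows the constant is zero.
  have hz := congrFun this a
  simp only [ha, zero_sub, Pi.zero_apply, neg_eq_zero] at hz
  simpa [hz] using this

variable {n : ℕ} (L : A ≃ ZMod (2 * n)) (hL : ∀ x y, L (x * y) = L x + L y)

include hL

theorem log_one : L 1 = 0 := by simpa using hL 1 1

theorem log_inv (x : A) : L x⁻¹ = -L x := by
  rw [eq_neg_iff_add_eq_zero, ← hL, inv_mul_cancel, log_one L hL]

theorem translate_log_matching {σ : A → A} (hσ : Involutive σ) (ρ : A) :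
    translate (-L ρ) (Sym2.map L '' matching σ) = Sym2.map L '' matching (conjMul ρ σ) := by
  rw [translate, Set.image_image]
  have hLρ : ∀ x, L x + -L ρ = L (x * ρ⁻¹) := fun x => by rw [hL, log_inv L hL]
  ext e
  constructor
  · rintro ⟨_, ⟨x, hx, rfl⟩, rfl⟩
    refine ⟨s(x * ρ⁻¹, σ x * ρ⁻¹), ?_, by simp [hLρ]⟩
    rw [mk_mem_matching (conjMul_involutive hσ ρ)]
    simpa [conjMul] using hx.symm
  · rintro ⟨_, ⟨x, hx, rfl⟩, rfl⟩
    refine ⟨s(x * ρ, σ (x * ρ)), ?_, by simp [hLρ, conjMul]⟩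
    rw [mk_mem_matching hσ]
    refine ⟨rfl, fun h => hx ?_⟩
    rw [conjMul, ← h, mul_inv_cancel_right]

theorem isTwin_log_matching {σ : A → A} (hσ : Involutive σ) {ρ : A} (hρ : ρ ≠ 1)
    (hfix : ∀ x, σ x = x ↔ x = 1 ∨ x = ρ) :
    IsTwin (Sym2.map L '' matching σ) (Sym2.map L '' matching (conjMul ρ σ)) := by
  refine ⟨L ρ, fun a => ?_, (translate_log_matching L hL hσ ρ).symm⟩
  obtain ⟨x, rfl⟩ := L.surjective a
  have h1 : (∀ e ∈ Sym2.map L '' matching σ, L x ∉ e) ↔ σ x = x := by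
    rw [← not_iff_not, ← Ne, ← exists_mem_matching hσ]
    simp [Sym2.mem_map]
  rw [h1, hfix, L.injective.eq_iff, ← log_one L hL, Ne, L.injective.eq_iff]
  constructor
  · rintro ⟨h, h'⟩
    exact h'.resolve_left h
  · rintro rfl
    exact ⟨hρ, Or.inr rfl⟩

theorem IsSeparating.isAdmissible [NeZero n] {σ : A → A} (h : IsSeparating σ)
    (hσ : Involutive σ) {ρ : A}
    (hρ : ρ ≠ 1) (hfix : ∀ x, σ x = x ↔ x = 1 ∨ x = ρ) :
    IsAdmissible (Sym2.map L '' matching σ) := by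
  have : Finite A := Finite.of_equiv _ L.symm
  refine ⟨?_, ?_, ?_⟩
  · rw [Set.ncard_image_of_injective _ (Sym2.map.injective L.injective)]
    refine ncard_matching hσ ?_ hρ.symm hfix
    rw [Nat.card_congr L, Nat.card_zmod]
  · rintro _ ⟨_, ⟨x, hx, rfl⟩, rfl⟩
    simpa using hx.symm
  · intro m k hmk f hm hk hfm hfk
    obtain ⟨a, rfl⟩ := L.surjective m
    obtain ⟨b, rfl⟩ := L.surjective k
    have key : ∀ c, (∀ x y, s(x, y) ∈ Sym2.map L '' matching σ → f (x + L c) = f (y + L c)) →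
        ∀ x, (f ∘ L) (σ x * c) = (f ∘ L) (x * c) := by
      intro c hc x
      by_cases hx : σ x = x
      · rw [hx]
      · simpa [hL] using (hc (L x) (L (σ x)) ⟨_, ⟨x, hx, rfl⟩, by simp⟩).symm
    have := h a b (fun h => hmk (h ▸ rfl)) (f ∘ L) hm hk (key a hfm) (key b hfk)
    funext z
    simpa using congrFun this (L.symm z)

end Separating

/-! ### The discrete logarithm as an isomorphism -/

theorem exists_log {A : Type*} [CommGroup A] [Finite A] {N : ℕ} [NeZero N] (hA : Nat.card A = N)
    (g : A) (hg : ∀ x : A, x ∈ Subgroup.zpowers g) :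
    ∃ L : A ≃ ZMod N, (∀ x y, L (x * y) = L x + L y) ∧ dlog N g = L := by
  have ho : orderOf g = N := by rw [orderOf_eq_card_of_forall_mem_zpowers hg, hA]
  have hspec : ∀ x : A, g ^ sInf {i : ℕ | g ^ i = x} = x := fun x =>
    Nat.sInf_mem (s := {i : ℕ | g ^ i = x})
      ((isOfFinOrder_of_finite g).mem_powers_iff_mem_zpowers.2 (hg x))
  have hpow : ∀ i j : ℕ, g ^ i = g ^ j ↔ (i : ZMod N) = j := fun i j => by
    rw [pow_eq_pow_iff_modEq, ho, ZMod.natCast_eq_natCast_iff]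
  have hval : ∀ x, g ^ (dlog N g x).val = x := fun x => by
    conv_rhs => rw [← hspec x]
    rw [hpow, ZMod.natCast_zmod_val]
    rfl
  have hdlog : ∀ k : ZMod N, dlog N g (g ^ k.val) = k := fun k => by
    have := (hpow _ _).1 (hval (g ^ k.val))
    simpa using this
  refine ⟨⟨dlog N g, fun k => g ^ k.val, hval, hdlog⟩, fun x y => ?_, rfl⟩
  have : g ^ (dlog N g x + dlog N g y).val = x * y := by
    conv_rhs => rw [← hval x, ← hval y, ← pow_add]
    rw [hpow]
    simp
  change dlog N g (x * y) = dlog N g x + dlog N g y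
  rw [← this, hdlog]


/-! ### Functions invariant under two reflections of `ZMod p` -/

section Reflections

variable {p : ℕ} [Fact p.Prime]

theorem forall_of_reflections {P : ZMod p → Prop} {a b : ZMod p} (hab : a ≠ b)
    (ha : ∀ x, P x → P (a - x)) (hb : ∀ x, P x → P (b - x)) {x : ZMod p} (hx : P x)
    (y : ZMod p) : P y := by
  have hshift : ∀ m : ℕ, P (x + m * (b - a)) := by
    intro m
    induction m with
    | zero => simpa using hx
    | succ m ih =>
      have := hb _ (ha _ ih)
      convert this using 1
      push_cast
      ring
  have hd : b - a ≠ 0 := sub_ne_zero.2 hab.symm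
  -- This many steps of length `b - a` lead from `x` to `y`.
  have := hshift ((y - x) / (b - a)).val
  rwa [ZMod.natCast_zmod_val, div_mul_cancel₀ _ hd, add_sub_cancel] at this

theorem eq_zero_of_reflections {F : ZMod p → ZMod 2} {a b : ZMod p} (hab : a ≠ b)
    (ha : ∀ x, F (a - x) = F x) (hb : ∀ x, F (b - x) = F x) (h0 : F 0 = 0) (y : ZMod p) :
    F y = 0 := by
  by_contra hy
  exact forall_of_reflections (P := fun x => F x ≠ 0) hab (fun x hx => by rwa [ha])
    (fun x hx => by rwa [hb]) hy 0 h0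

theorem eq_of_switched_reflections (h2 : (2 : ZMod p) ≠ 0) (h3 : (3 : ZMod p) ≠ 0)
    {F : ZMod p → ZMod 2} {a b : ZMod p} (hab : a ≠ b) (ha0 : a ≠ 0) (hb0 : b ≠ 0)
    (ha : ∀ x, x ≠ 2 * a → x ≠ -a → F (a - x) = F x) (ha' : F (a / 2) = F (-a))
    (hb : ∀ x, x ≠ 2 * b → x ≠ -b → F (b - x) = F x) (hb' : F (b / 2) = F (-b))
    (hs : F (2 * a) = F (2 * b)) (x : ZMod p) : F x = F (-a) := by
  -- Both values equal `F (a + b)`, unless `-b = 2a` or `-a = 2b`; in those cases the extra edge at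
  -- `a / 2` or `b / 2` links them directly.
  have hu : F (-b) = F (-a) := by
    by_cases h1 : b = -a / 2
    · rw [← ha']
      congr 1
      rw [h1]
      ring
    by_cases h1' : a = -b / 2
    · rw [← hb']
      congr 1
      rw [h1']
      ring
    have e1 : F (a - -b) = F (-b) := by
      refine ha _ (fun h => h1' ?_) (fun h => hab (neg_injective h).symm)
      field_simp
      linear_combination -h
    have e2 : F (b - -a) = F (-a) := by
      refine hb _ (fun h => h1 ?_) (fun h => hab (neg_injective h))
      field_simp
      linear_combination -h
    rw [← e1, ← e2]
    congr 1
    ring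
  set u := F (-a) with hu_def
  have hBa : ∀ x, F x ≠ u → x ≠ 2 * a → F (a - x) ≠ u := by
    intro x hx h
    rwa [ha x h]
    rintro rfl
    exact hx rfl
  have hBb : ∀ x, F x ≠ u → x ≠ 2 * b → F (b - x) ≠ u := by
    intro x hx h
    rwa [hb x h]
    rintro rfl
    exact hx hu
  by_contra hx
  -- If `F (2a) = u`, the set `F ≠ u` avoids the exceptional points, so both reflections preserve
  -- it; yet it misses `a / 2`.
  by_cases hau : F (2 * a) = u
  · refine forall_of_reflections (P := fun x => F x ≠ u) hab (fun x hx => hBa x hx ?_)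
      (fun x hx => hBb x hx ?_) hx (a / 2) ha'
    · rintro rfl
      exact hx hau
    · rintro rfl
      exact hx (hs ▸ hau)
  · have hbu : F (2 * b) ≠ u := hs ▸ hau
    -- Three added points close the set under both reflections: `a - x` swaps `2a` with `-a` and
    -- `-b` with `a + b`, and symmetrically for `b`.
    have hall := forall_of_reflections (P := fun x => F x ≠ u ∨ x = -a ∨ x = -b ∨ x = a + b) hab
      (by
        rintro x (hx | rfl | rfl | rfl)
        · by_cases h : x = 2 * a
          · right; left
            rw [h]
            ring
          · exact Or.inl (hBa x hx h)
        · left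
          rwa [show a - -a = 2 * a by ring]
        · right; right; right
          ring
        · right; right; left
          ring)
      (by
        rintro x (hx | rfl | rfl | rfl)
        · by_cases h : x = 2 * b
          · right; right; left
            rw [h]
            ring
          · exact Or.inl (hBb x hx h)
        · right; right; right
          ring
        · left
          rwa [show b - -b = 2 * b by ring]
        · right; left
          ring) (Or.inl hx)
    have h3a : 3 * a ≠ 0 := mul_ne_zero h3 ha0
    have h3b : 3 * b ≠ 0 := mul_ne_zero h3 hb0
    -- The closed set is everything, so `a / 2` and `b / 2` must be among the added points. This
    -- forces `a + 2b = 0` and `b + 2a = 0`, hence `3a = 0`.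
    have hab2 : a + 2 * b = 0 := by
      rcases hall (a / 2) with h | h | h | h
      · exact absurd ha' h
      · rw [div_eq_iff h2] at h
        exact absurd (by linear_combination h) h3a
      · field_simp at h
        linear_combination h
      · field_simp at h
        linear_combination -h
    rcases hall (b / 2) with h | h | h | h
    · exact h (hb'.trans hu)
    · field_simp at h
      exact h3a (by linear_combination -hab2 + 2 * h)
    · rw [div_eq_iff h2] at h
      exact h3b (by linear_combination h)
    · field_simp at h
      exact h3a (by linear_combination -hab2 - 2 * h)

end Reflections

/-! ### The reflection of the units and its switched variant -/

section Units

variable {p : ℕ} [Fact p.Prime]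

/-- The extension by zero of a function on the units. -/
def extendZero (f : (ZMod p)ˣ → ZMod 2) (z : ZMod p) : ZMod 2 :=
  if h : z = 0 then 0 else f (Units.mk0 z h)

theorem extendZero_coe (f : (ZMod p)ˣ → ZMod 2) (x : (ZMod p)ˣ) : extendZero f x = f x := by
  simp [extendZero]

theorem extendZero_zero (f : (ZMod p)ˣ → ZMod 2) : extendZero f 0 = 0 := by
  simp [extendZero]

/-- The involution `x ↦ 1 - x`, fixing `1`. -/
def reflect (x : (ZMod p)ˣ) : (ZMod p)ˣ :=
  if h : (x : ZMod p) = 1 then 1 else Units.mk0 (1 - x) (sub_ne_zero.2 (Ne.symm h))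

theorem reflect_one : reflect (1 : (ZMod p)ˣ) = 1 := by simp [reflect]

theorem coe_reflect {x : (ZMod p)ˣ} (hx : x ≠ 1) : (reflect x : ZMod p) = 1 - x := by
  have : (x : ZMod p) ≠ 1 := by simpa using hx
  simp [reflect, this]

theorem reflect_ne_one {x : (ZMod p)ˣ} (hx : x ≠ 1) : reflect x ≠ 1 := by
  intro h
  have := coe_reflect hx
  rw [h, Units.val_one] at this
  exact x.ne_zero (by linear_combination this)

theorem reflect_involutive : Involutive (reflect : (ZMod p)ˣ → (ZMod p)ˣ) := by
  intro x
  by_cases hx : x = 1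
  · rw [hx, reflect_one, reflect_one]
  · ext
    rw [coe_reflect (reflect_ne_one hx), coe_reflect hx, sub_sub_cancel]

theorem reflect_eq_iff {x y : (ZMod p)ˣ} (hx : x ≠ 1) :
    reflect x = y ↔ (x : ZMod p) + y = 1 := by
  rw [Units.ext_iff, coe_reflect hx, sub_eq_iff_eq_add', eq_comm]

variable {t : (ZMod p)ˣ} (ht : (t : ZMod p) = 2)

include ht

theorem coe_inv_two : ((t⁻¹ : (ZMod p)ˣ) : ZMod p) = 2⁻¹ := by
  rw [Units.val_inv_eq_inv_val, ht]

theorem eq_inv_two_iff {x : (ZMod p)ˣ} : x = t⁻¹ ↔ (x : ZMod p) + x = 1 := by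
  rw [eq_inv_iff_mul_eq_one, Units.ext_iff, Units.val_mul, ht, mul_two, Units.val_one]

theorem two_unit_ne_one : t ≠ 1 := by
  rintro rfl
  have : (1 : ZMod p) = 0 := by
    rw [Units.val_one] at ht
    linear_combination -ht
  exact one_ne_zero this

theorem reflect_eq_self_iff (x : (ZMod p)ˣ) : reflect x = x ↔ x = 1 ∨ x = t⁻¹ := by
  by_cases hx : x = 1
  · simp [hx, reflect_one]
  · rw [reflect_eq_iff hx, eq_inv_two_iff ht]
    simp [hx]

omit ht in
theorem isSeparating_reflect : IsSeparating (reflect : (ZMod p)ˣ → (ZMod p)ˣ) := by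
  intro a b hab f ha hb hfa hfb
  have key : ∀ c : (ZMod p)ˣ, f c = 0 → (∀ x, f (reflect x * c) = f (x * c)) →
      ∀ z : ZMod p, extendZero f (c - z) = extendZero f z := by
    intro c hc h z
    rcases eq_or_ne z 0 with rfl | hz
    · rw [sub_zero, extendZero_coe, hc, extendZero_zero]
    obtain ⟨x, rfl⟩ : ∃ x : (ZMod p)ˣ, z = ((x * c : (ZMod p)ˣ) : ZMod p) :=
      ⟨Units.mk0 z hz * c⁻¹, by simp⟩
    -- Here the reflection exchanges `c` and `0`, and the extended function vanishes at both.
    by_cases hx : x = 1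
    · simp [hx, extendZero_zero, extendZero_coe, hc]
    · rw [extendZero_coe, ← h x, ← extendZero_coe f, Units.val_mul, Units.val_mul, coe_reflect hx]
      ring_nf
  funext x
  rw [← extendZero_coe f]
  exact eq_zero_of_reflections (fun h => hab (Units.ext h)) (key a ha hfa) (key b hb hfb)
    (extendZero_zero f) x

omit ht

/-- The involution `x ↦ 1 - x`, fixing `1`, with the pair `{t, -1}` replaced by `{t⁻¹, -1}`. -/
def switchedReflect (t x : (ZMod p)ˣ) : (ZMod p)ˣ :=
  if x = t then t else if x = -1 then t⁻¹ else if x = t⁻¹ then -1 else reflect x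

theorem switchedReflect_self (t : (ZMod p)ˣ) : switchedReflect t t = t := by
  simp [switchedReflect]

theorem switchedReflect_of_ne {x : (ZMod p)ˣ} (h : x ≠ t) (h' : x ≠ -1) (h'' : x ≠ t⁻¹) :
    switchedReflect t x = reflect x := by
  simp [switchedReflect, h, h', h'']

include ht

variable (h3 : (3 : ZMod p) ≠ 0)

include h3

theorem neg_one_ne_two_unit : -1 ≠ t := by
  intro h
  rw [← h, Units.val_neg, Units.val_one] at ht
  exact h3 (by linear_combination -ht)

theorem neg_one_ne_inv_two_unit : -1 ≠ t⁻¹ := by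
  intro h
  rw [eq_inv_two_iff ht, Units.val_neg, Units.val_one] at h
  exact h3 (by linear_combination -h)

theorem inv_two_unit_ne : t⁻¹ ≠ t := by
  intro h
  have := (eq_inv_two_iff ht).1 h.symm
  rw [ht] at this
  exact h3 (by linear_combination this)

omit h3 in
theorem neg_one_ne_one_unit : (-1 : (ZMod p)ˣ) ≠ 1 := by
  intro h
  rw [Units.ext_iff, Units.val_neg, Units.val_one] at h
  exact t.ne_zero (by rw [ht]; linear_combination -h)

theorem switchedReflect_neg_one : switchedReflect t (-1) = t⁻¹ := by
  simp [switchedReflect, neg_one_ne_two_unit ht h3]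

theorem switchedReflect_inv : switchedReflect t t⁻¹ = -1 := by
  simp [switchedReflect, inv_two_unit_ne ht h3, (neg_one_ne_inv_two_unit ht h3).symm]

omit h3 in
-- The reflection swaps `2` and `-1` and fixes `2⁻¹`, so the complement of these three points is
-- stable.
theorem reflect_mem_generic {x : (ZMod p)ˣ} (h : x ≠ t) (h' : x ≠ -1) (h'' : x ≠ t⁻¹) :
    reflect x ≠ t ∧ reflect x ≠ -1 ∧ reflect x ≠ t⁻¹ := by
  by_cases hx : x = 1
  · subst hx
    rw [reflect_one]
    exact ⟨h, h', h''⟩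
  refine ⟨fun H => h' ?_, fun H => h ?_, fun H => h'' ?_⟩
  · rw [reflect_eq_iff hx, ht] at H
    ext
    rw [Units.val_neg, Units.val_one]
    linear_combination H
  · rw [reflect_eq_iff hx, Units.val_neg, Units.val_one] at H
    ext
    rw [ht]
    linear_combination H
  · rw [← reflect_involutive x, H, (reflect_eq_self_iff ht _).2 (Or.inr rfl)]

theorem switchedReflect_involutive : Involutive (switchedReflect t) := by
  intro x
  by_cases h : x = t
  · rw [h, switchedReflect_self, switchedReflect_self]
  by_cases h' : x = -1
  · rw [h', switchedReflect_neg_one ht h3, switchedReflect_inv ht h3]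
  by_cases h'' : x = t⁻¹
  · rw [h'', switchedReflect_inv ht h3, switchedReflect_neg_one ht h3]
  obtain ⟨k, k', k''⟩ := reflect_mem_generic ht h h' h''
  rw [switchedReflect_of_ne h h' h'', switchedReflect_of_ne k k' k'', reflect_involutive]

theorem switchedReflect_eq_self_iff (x : (ZMod p)ˣ) :
    switchedReflect t x = x ↔ x = 1 ∨ x = t := by
  by_cases h : x = t
  · simp [h, switchedReflect_self]
  by_cases h' : x = -1
  · rw [h', switchedReflect_neg_one ht h3]
    simp [(neg_one_ne_inv_two_unit ht h3).symm, neg_one_ne_one_unit ht,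
      neg_one_ne_two_unit ht h3]
  by_cases h'' : x = t⁻¹
  · rw [h'', switchedReflect_inv ht h3]
    simp [neg_one_ne_inv_two_unit ht h3, two_unit_ne_one ht, inv_two_unit_ne ht h3]
  · rw [switchedReflect_of_ne h h' h'', reflect_eq_self_iff ht]
    simp [h, h'']

theorem isSeparating_switchedReflect : IsSeparating (switchedReflect t) := by
  intro a b hab f ha hb hfa hfb
  have h2 : (2 : ZMod p) ≠ 0 := ht ▸ t.ne_zero
  have key : ∀ c : (ZMod p)ˣ, f c = 0 → (∀ x, f (switchedReflect t x * c) = f (x * c)) →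
      (∀ z : ZMod p, z ≠ 2 * c → z ≠ -c → extendZero f (c - z) = extendZero f z) ∧
        extendZero f (c / 2) = extendZero f (-c) := by
    intro c hc h
    constructor
    · intro z hz2 hz1
      rcases eq_or_ne z 0 with rfl | hz
      · rw [sub_zero, extendZero_coe, hc, extendZero_zero]
      obtain ⟨x, rfl⟩ : ∃ x : (ZMod p)ˣ, z = ((x * c : (ZMod p)ˣ) : ZMod p) :=
        ⟨Units.mk0 z hz * c⁻¹, by simp⟩
      have k : x ≠ t := by
        rintro rfl
        exact hz2 (by rw [Units.val_mul, ht])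
      have k' : x ≠ -1 := by
        rintro rfl
        exact hz1 (by simp)
      by_cases hx : x = 1
      · simp [hx, extendZero_zero, extendZero_coe, hc]
      -- The point `c / 2` is the centre of the reflection, so nothing is lost by switching its
      -- edge.
      by_cases k'' : x = t⁻¹
      · have := (eq_inv_two_iff ht).1 k''
        congr 1
        rw [Units.val_mul]
        linear_combination -(c : ZMod p) * this
      · rw [extendZero_coe, ← h x, ← extendZero_coe f, Units.val_mul, Units.val_mul,
          switchedReflect_of_ne k k' k'', coe_reflect hx]
        ring_nf
    · have e1 : (c : ZMod p) / 2 = ((t⁻¹ * c : (ZMod p)ˣ) : ZMod p) := by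
        rw [Units.val_mul, coe_inv_two ht, div_eq_inv_mul]
      have e2 : -(c : ZMod p) = ((-1 * c : (ZMod p)ˣ) : ZMod p) := by simp
      rw [e1, e2, extendZero_coe, extendZero_coe, ← h (-1), switchedReflect_neg_one ht h3]
  have hs := apply_mul_eq_of_sum (switchedReflect_involutive ht h3) (two_unit_ne_one ht)
    (switchedReflect_eq_self_iff ht h3) hfa hfb
  rw [ha, hb, zero_add, zero_add, ← extendZero_coe f, ← extendZero_coe f, Units.val_mul,
    Units.val_mul, ht] at hs
  have hconst := eq_of_switched_reflections h2 h3 (fun h => hab (Units.ext h)) a.ne_zero b.ne_zero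
    (key a ha hfa).1 (key a ha hfa).2 (key b hb hfb).1 (key b hb hfb).2 hs
  funext x
  rw [← extendZero_coe f, hconst, ← hconst 0, extendZero_zero, Pi.zero_apply]

/-! ### The starters as matchings and their quotients -/

omit h3 in
theorem starterA_eq : starterA p = matching reflect := by
  ext e
  simp only [starterA, matching, Set.mem_ofPred_eq, Set.mem_insert_iff, Set.mem_singleton_iff,
    not_or, ← coe_inv_two ht, Units.val_eq_one, Units.val_inj]
  constructor
  · rintro ⟨x, y, rfl, hx, hy, h⟩
    rw [← reflect_eq_iff hx.1] at h
    refine ⟨x, ?_, by rw [h]⟩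
    rw [Ne, reflect_eq_self_iff ht, not_or]
    exact hx
  · rintro ⟨x, hx, rfl⟩
    have hx' : ¬ reflect (reflect x) = reflect x := by
      rw [reflect_involutive]
      exact hx.symm
    rw [Ne, reflect_eq_self_iff ht, not_or] at hx
    rw [reflect_eq_self_iff ht, not_or] at hx'
    exact ⟨x, _, rfl, hx, hx', (reflect_eq_iff hx.1).1 rfl⟩

theorem starterB_eq : starterB p = matching (switchedReflect t) := by
  ext e
  have hm : (-1 : ZMod p) = ((-1 : (ZMod p)ˣ) : ZMod p) := by simp
  simp only [starterB, Set.mem_union, Set.mem_ofPred_eq, Set.mem_insert_iff,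
    Set.mem_singleton_iff, not_or, ← coe_inv_two ht, Units.val_eq_one, hm, Units.val_inj]
  simp only [← ht, Units.val_inj]
  constructor
  · rintro (⟨x, y, rfl, ⟨h1, h2, h3', h4⟩, hy, h⟩ | ⟨x, y, rfl, rfl, rfl⟩)
    · rw [← reflect_eq_iff h1] at h
      refine ⟨x, ?_, by rw [switchedReflect_of_ne h3' h4 h2, h]⟩
      rw [Ne, switchedReflect_eq_self_iff ht h3, not_or]
      exact ⟨h1, h3'⟩
    · rw [mk_mem_matching (switchedReflect_involutive ht h3)]
      exact ⟨switchedReflect_inv ht h3, (neg_one_ne_inv_two_unit ht h3).symm⟩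
  · rintro ⟨x, hx, rfl⟩
    rw [Ne, switchedReflect_eq_self_iff ht h3, not_or] at hx
    by_cases h' : x = -1
    · rw [h', switchedReflect_neg_one ht h3]
      exact Or.inr ⟨_, _, Sym2.eq_swap, rfl, rfl⟩
    by_cases h'' : x = t⁻¹
    · rw [h'', switchedReflect_inv ht h3]
      exact Or.inr ⟨_, _, rfl, rfl, rfl⟩
    obtain ⟨k, k', k''⟩ := reflect_mem_generic ht hx.2 h' h''
    rw [switchedReflect_of_ne hx.2 h' h'']
    exact Or.inl ⟨x, _, rfl, ⟨hx.1, h'', hx.2, h'⟩, ⟨reflect_ne_one hx.1, k'', k, k'⟩,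
      (reflect_eq_iff hx.1).1 rfl⟩

omit h3 in
theorem orderOf_eq_two_iff (x : (ZMod p)ˣ) : orderOf x = 2 ↔ x = -1 := by
  rw [orderOf_eq_prime_iff]
  constructor
  · rintro ⟨h, h'⟩
    have h2 : (x : ZMod p) ^ 2 = 1 := by rw [← Units.val_pow_eq_pow_val, h, Units.val_one]
    rcases sq_eq_one_iff.1 h2 with h | h
    · exact absurd (Units.ext h) h'
    · exact Units.ext (by simpa using h)
  · rintro rfl
    exact ⟨by simp, neg_one_ne_one_unit ht⟩

omit h3 in
theorem isEvenStarter_matching {n : ℕ} (hp : p = 2 * n + 1) {σ : (ZMod p)ˣ → (ZMod p)ˣ}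
    (hσ : Involutive σ) {ρ : (ZMod p)ˣ} (hρ : ρ ≠ 1) (hfix : ∀ x, σ x = x ↔ x = 1 ∨ x = ρ)
    (hquot : ∀ i : (ZMod p)ˣ, i ≠ 1 → i ≠ -1 →
      ∃ x, i = x⁻¹ * σ x ∨ i = x * (σ x)⁻¹) :
    IsEvenStarter n (matching σ) := by
  have hcard : Nat.card (ZMod p)ˣ = 2 * n := by
    rw [Nat.card_eq_fintype_card, ZMod.card_units, hp, Nat.add_sub_cancel]
  refine ⟨hcard, ?_, Set.toFinite _, ncard_matching hσ hcard hρ.symm hfix, ?_, ?_⟩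
  · exact ⟨-1, (orderOf_eq_two_iff ht _).2 rfl, fun x hx => (orderOf_eq_two_iff ht x).1 hx⟩
  · intro e he
    refine ⟨not_isDiag_of_mem_matching he, fun h1 => ?_⟩
    exact (exists_mem_matching hσ 1).1 ⟨e, he, h1⟩ ((hfix 1).2 (Or.inl rfl))
  · intro i hi hi2
    rw [Ne, orderOf_eq_two_iff ht] at hi2
    obtain ⟨x, hx⟩ := hquot i hi hi2
    refine ⟨x, σ x, ⟨x, fun h => hi ?_, rfl⟩, hx⟩
    rw [h] at hx
    simpa using hx

omit ht h3 in
-- Solving `(1 - x) / x = i` gives `x = (1 + i)⁻¹`.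
theorem exists_reflect_quotient {i : (ZMod p)ˣ} (hi : i ≠ -1) :
    ∃ x : (ZMod p)ˣ, x ≠ 1 ∧ x * (1 + i) = (1 : ZMod p) ∧ i = x⁻¹ * reflect x := by
  have h1 : (1 + i : ZMod p) ≠ 0 := by
    intro h
    refine hi (Units.ext ?_)
    rw [Units.val_neg, Units.val_one]
    linear_combination h
  have hmul : ((Units.mk0 _ h1)⁻¹ : (ZMod p)ˣ) * (1 + i) = (1 : ZMod p) := by
    simp [h1]
  have hne : (Units.mk0 _ h1)⁻¹ ≠ 1 := by
    intro h
    rw [h, Units.val_one, one_mul, add_eq_left] at hmul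
    exact i.ne_zero hmul
  refine ⟨(Units.mk0 _ h1)⁻¹, hne, hmul, ?_⟩
  rw [eq_inv_mul_iff_mul_eq]
  ext
  rw [coe_reflect hne, Units.val_mul]
  linear_combination hmul

omit h3 in
theorem isEvenStarter_starterA {n : ℕ} (hp : p = 2 * n + 1) : IsEvenStarter n (starterA p) := by
  rw [starterA_eq ht]
  refine isEvenStarter_matching ht hp reflect_involutive
    (by simpa using two_unit_ne_one ht) (reflect_eq_self_iff ht) fun i _ hi => ?_
  obtain ⟨x, -, -, hx⟩ := exists_reflect_quotient hi
  exact ⟨x, Or.inl hx⟩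

/-- The switch costs no quotient: the removed pair `{2, -1}` and the new pair `{2⁻¹, -1}` both have
quotients `-2` and `-2⁻¹`. -/
theorem isEvenStarter_starterB {n : ℕ} (hp : p = 2 * n + 1) : IsEvenStarter n (starterB p) := by
  rw [starterB_eq ht h3]
  refine isEvenStarter_matching ht hp (switchedReflect_involutive ht h3)
    (two_unit_ne_one ht) (switchedReflect_eq_self_iff ht h3) fun i hi1 hi => ?_
  obtain ⟨x, hx1, hxi, hx⟩ := exists_reflect_quotient hi
  by_cases h : x = t
  · refine ⟨-1, Or.inl ?_⟩
    rw [switchedReflect_neg_one ht h3]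
    rw [hx, h, inv_mul_eq_iff_eq_mul, (reflect_eq_iff (two_unit_ne_one ht) (y := -1)).2]
    · simp
    · rw [ht, Units.val_neg, Units.val_one]
      ring
  by_cases h' : x = -1
  · refine ⟨-1, Or.inr ?_⟩
    rw [switchedReflect_neg_one ht h3]
    rw [hx, h', (reflect_eq_iff (neg_one_ne_one_unit ht) (y := t)).2]
    · simp
    · rw [ht, Units.val_neg, Units.val_one]
      ring
  by_cases h'' : x = t⁻¹
  · rw [h'', (reflect_eq_self_iff ht _).2 (Or.inr rfl), inv_mul_cancel] at hx
    exact absurd hx hi1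
  · exact ⟨x, Or.inl (by rwa [switchedReflect_of_ne h h' h''])⟩

end Units


/-! ### Distinctness of the four edge sets -/

section Distinct

variable {p : ℕ} [Fact p.Prime] {t : (ZMod p)ˣ} (ht : (t : ZMod p) = 2)
  (h3 : (3 : ZMod p) ≠ 0)

include ht

theorem coe_conjMul_reflect_inv_two (h3 : (3 : ZMod p) ≠ 0) :
    ((conjMul t⁻¹ reflect t⁻¹ : (ZMod p)ˣ) : ZMod p) * 2 = 3 := by
  have h1 : t⁻¹ * t⁻¹ ≠ 1 := by
    rw [Ne, mul_eq_one_iff_eq_inv, inv_inv]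
    exact inv_two_unit_ne ht h3
  have h2 : (2 : ZMod p) ≠ 0 := ht ▸ t.ne_zero
  rw [conjMul, inv_inv, Units.val_mul, coe_reflect h1, Units.val_mul, coe_inv_two ht, ht]
  field_simp
  norm_num

include h3

/-- At `2⁻¹` the four involutions take the values `1/2, 3/2, -1, 1/2`; at `-2⁻¹` the first and last
take `3/2` and `1/4`. The coincidences `3/2 = -1` and `3/2 = 1/4` each amount to `5 = 0`. -/
theorem pairwise_ne_of_matching (h5 : (5 : ZMod p) ≠ 0) :
    [matching reflect, matching (conjMul t⁻¹ reflect), matching (switchedReflect t),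
      matching (conjMul t (switchedReflect t))].Pairwise (· ≠ ·) := by
  have h2 : (2 : ZMod p) ≠ 0 := ht ▸ t.ne_zero
  have hA := reflect_involutive (p := p)
  have hA' := conjMul_involutive hA t⁻¹
  have hB := switchedReflect_involutive ht h3
  have hB' := conjMul_involutive hB t
  have vA : reflect t⁻¹ = t⁻¹ := (reflect_eq_self_iff ht _).2 (Or.inr rfl)
  have vA' := coe_conjMul_reflect_inv_two ht h3
  have vB : switchedReflect t t⁻¹ = -1 := switchedReflect_inv ht h3
  have vB' : conjMul t (switchedReflect t) t⁻¹ = t⁻¹ :=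
    (conjMul_eq_self_iff (switchedReflect_eq_self_iff ht h3) _).2 (Or.inr rfl)
  have hinv : ((t⁻¹ : (ZMod p)ˣ) : ZMod p) * 2 = 1 := by rw [coe_inv_two ht, inv_mul_cancel₀ h2]
  have hAA' : conjMul t⁻¹ reflect t⁻¹ ≠ t⁻¹ := by
    intro h
    rw [h, hinv] at vA'
    exact h2 (by linear_combination -vA')
  have hBA : (-1 : (ZMod p)ˣ) ≠ t⁻¹ := neg_one_ne_inv_two_unit ht h3
  have hw : -t⁻¹ ≠ 1 := by
    intro h
    rw [neg_eq_iff_eq_neg] at h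
    exact hBA h.symm
  have wA : (reflect (-t⁻¹) : ZMod p) * 2 = 3 := by
    rw [coe_reflect hw, Units.val_neg]
    linear_combination hinv
  have wB' : ((conjMul t (switchedReflect t) (-t⁻¹) : (ZMod p)ˣ) : ZMod p) * 4 = 1 := by
    have : -t⁻¹ * t = -1 := by simp
    rw [conjMul, this, switchedReflect_neg_one ht h3, Units.val_mul]
    linear_combination (((t⁻¹ : (ZMod p)ˣ) : ZMod p) * 2 + 1) * hinv
  simp only [List.pairwise_cons, List.mem_cons, List.not_mem_nil, or_false, forall_eq_or_imp,
    forall_eq, List.Pairwise.nil, and_true, false_imp_iff, forall_const]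
  refine ⟨⟨fun h => ?_, fun h => ?_, fun h => ?_⟩, ⟨fun h => ?_, fun h => ?_⟩, fun h => ?_⟩
  · have := congrFun (matching_injective hA hA' h) t⁻¹
    exact hAA' (this.symm.trans vA)
  · have := congrFun (matching_injective hA hB h) t⁻¹
    exact hBA (vB.symm.trans (this.symm.trans vA))
  · have := congrFun (matching_injective hA hB' h) (-t⁻¹)
    rw [this] at wA
    exact h5 (by linear_combination wB' - 2 * wA)
  · have := congrFun (matching_injective hA' hB h) t⁻¹
    rw [this, vB, Units.val_neg, Units.val_one] at vA'
    exact h5 (by linear_combination -vA')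
  · have := congrFun (matching_injective hA' hB' h) t⁻¹
    exact hAA' (this.trans vB')
  · have := congrFun (matching_injective hB hB' h) t⁻¹
    exact hBA (vB.symm.trans (this.trans vB'))

end Distinct

theorem natCast_ne_zero_of_lt {p m : ℕ} (hm : 0 < m) (hmp : m < p) : (m : ZMod p) ≠ 0 := by
  rw [Ne, ZMod.natCast_eq_zero_iff]
  exact Nat.not_dvd_of_pos_of_lt hm hmp

end CCode

open CCode

theorem mainTheorem4 (p n : ℕ) [Fact p.Prime] [NeZero n] (hn : 2 ≤ n) (hp : p = 2 * n + 1)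
    (g : (ZMod p)ˣ) (hg : ∀ x : (ZMod p)ˣ, x ∈ Subgroup.zpowers g) :
    CCode.IsEvenStarter n (CCode.starterA p) ∧
    CCode.IsEvenStarter n (CCode.starterB p) ∧
    ∃ TA TB : Set (Sym2 (ZMod (2 * n))),
      CCode.IsTwin (CCode.logPairs (2 * n) g (CCode.starterA p)) TA ∧
      CCode.IsTwin (CCode.logPairs (2 * n) g (CCode.starterB p)) TB ∧
      (∃ 𝒞, CCode.IsCCode 𝒞 (CCode.logPairs (2 * n) g (CCode.starterA p))) ∧
      (∃ 𝒞, CCode.IsCCode 𝒞 TA) ∧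
      (∃ 𝒞, CCode.IsCCode 𝒞 (CCode.logPairs (2 * n) g (CCode.starterB p))) ∧
      (∃ 𝒞, CCode.IsCCode 𝒞 TB) ∧
      (7 ≤ p → [CCode.logPairs (2 * n) g (CCode.starterA p), TA,
        CCode.logPairs (2 * n) g (CCode.starterB p), TB].Pairwise (· ≠ ·)) := by
  have h2 : (2 : ZMod p) ≠ 0 := by
    exact_mod_cast natCast_ne_zero_of_lt (p := p) (m := 2) (by omega) (by omega)
  have h3 : (3 : ZMod p) ≠ 0 := by
    exact_mod_cast natCast_ne_zero_of_lt (p := p) (m := 3) (by omega) (by omega)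
  obtain ⟨t, ht⟩ : ∃ t : (ZMod p)ˣ, (t : ZMod p) = 2 := ⟨Units.mk0 2 h2, rfl⟩
  refine ⟨isEvenStarter_starterA ht hp, isEvenStarter_starterB ht h3 hp, ?_⟩
  have hcard : Nat.card (ZMod p)ˣ = 2 * n := by
    rw [Nat.card_eq_fintype_card, ZMod.card_units, hp, Nat.add_sub_cancel]
  obtain ⟨L, hL, hlog⟩ := exists_log hcard g hg
  rw [logPairs, logPairs, hlog, starterA_eq ht, starterB_eq ht h3]
  have hρA : t⁻¹ ≠ 1 := by simpa using two_unit_ne_one ht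
  have hρB : t ≠ 1 := two_unit_ne_one ht
  have hA := reflect_involutive (p := p)
  have hB := switchedReflect_involutive ht h3
  have fA := reflect_eq_self_iff ht
  have fB := switchedReflect_eq_self_iff ht h3
  have sA := isSeparating_reflect (p := p)
  have sB := isSeparating_switchedReflect ht h3
  refine ⟨_, _, isTwin_log_matching L hL hA hρA fA, isTwin_log_matching L hL hB hρB fB,
    (sA.isAdmissible L hL hA hρA fA).exists_isCCode,
    ((sA.conjMul hA hρA fA).isAdmissible L hL (conjMul_involutive hA _) (inv_ne_one.2 hρA)
      (conjMul_eq_self_iff fA)).exists_isCCode,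
    (sB.isAdmissible L hL hB hρB fB).exists_isCCode,
    ((sB.conjMul hB hρB fB).isAdmissible L hL (conjMul_involutive hB _) (inv_ne_one.2 hρB)
      (conjMul_eq_self_iff fB)).exists_isCCode, fun h7 => ?_⟩
  have h5 : (5 : ZMod p) ≠ 0 := by
    exact_mod_cast natCast_ne_zero_of_lt (p := p) (m := 5) (by omega) (by omega)
  have hinj : Function.Injective (fun S => Sym2.map L '' S) :=
    Set.image_injective.2 (Sym2.map.injective L.injective)
  exact (pairwise_ne_of_matching ht h3 h5).map _ fun _ _ h => hinj.ne h
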